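/- Let $(T,d)$ be a compact metric space and let $\mu$ be a finite (hence regular) Borel measure on $T$ with $\mu(\{t\})=0$ for every $t\in T$. Let $X$ be a real Banach lattice with order continuous norm (every nonempty downward directed set with infimum $0$ contains elements of arbitrarily small norm) that is weakly $\sigma$-distributive: $\bigwedge_{\varphi\in\mathbb{N}^{\mathbb{N}}}\bigvee_{i} a_{i,\varphi(i)}=0$ for every order bounded double sequence $(a_{i,j})$ in $X$ such that, for each $i$, $(a_{i,j})_j$ is decreasing with infimum $0$. Notation. Let $cwk(X)$ be the family of nonempty convex weakly compact subsets of $X$. An $(o)$-sequence is a decreasing sequence $(b_n)_n$ in $X$ with $\bigwedge_n b_n=0$. For $C\subset X$ and $b\in X$ put $\mathcal U(C,b)=\{z\in X: |z-y|\le b \text{ for some } y\in C\}$. A gauge is a map $\gamma:T\to(0,\infty)$. A partition of a Borel set $E\subset T$ is a finite family $\Pi=\{(E_i,t_i): i=1,\dots,k\}$ with $t_i\in T$ (not necessarily $t_i\in E_i$), $E_i$ Borel, $\mu(E_i\cap E_j)=0$ for $i\ne j$, and $\bigcup_i E_i=E$; it is $\gamma$-fine if $d(w,t_i)<\gamma(t_i)$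 for all $i$ and all $w\in E_i$. For $F:T\to cwk(X)$ let $\Sigma_\Pi(F)=\mathrm{cl}\big(\mu(E_1)F(t_1)+\dots+\mu(E_k)F(t_k)\big)$ (Minkowski sum). Integral. A set $J\in cwk(X)$ is the (oH)-integral of $F:T\to cwk(X)$ over $E$, written $J=\int_E F\,d\mu$, if there are an $(o)$-sequence $(\beta_n)_n$ in $X$ and a sequence $(\gamma_n)_n$ of gauges such that, for every $n$ and every $\gamma_n$-fine partition $\Pi$ of $E$, $\Sigma_\Pi(F)\subset\mathcal U(J,\beta_n)$ and $J\subset\mathcal U(\Sigma_\Pi(F),\beta_n)$ (such a $J$ is unique). $F$ is oH-integrable if it has an (oH)-integral over every Borel set $E\subset T$. All multifunctions below have order bounded values. Proposition 3.21. Let $F:T\to cwk(X)$ be a multifunction. Assume that there is an $(o)$-sequence $(b_n)_n$ in $X$ such that for every $n$ there exist oH-integrable multifunctions $G_1,G_2:T\to cwk(X)$ (depending on $n$) with $G_1(t)\subset F(t)\subset G_2(t)$ for every $t\in T$ and $$\int_T G_2\,d\mu\subset\mathcal U\Big(\int_T G_1\,d\mu,\;b_n\Big).$$ Then $F$ is oH-integrable.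 -/

import Mathlib

open MeasureTheory Set
open scoped Pointwise

/-- An (o)-sequence: a decreasing sequence with infimum `0`. -/
def IsOSequence {X : Type*} [Zero X] [Preorder X] (b : ℕ → X) : Prop :=
  Antitone b ∧ IsGLB (range b) 0

/-- The norm of `X` is order continuous: every nonempty downward directed set with infimum `0`
has elements of arbitrarily small norm. -/
def IsOrderContinuousNorm (X : Type*) [NormedAddCommGroup X] [PartialOrder X] : Prop :=
  ∀ A : Set X, A.Nonempty → DirectedOn (fun x y => y ≤ x) A → IsGLB A 0 →
    ∀ ε : ℝ, 0 < ε → ∃ x ∈ A, ‖x‖ < ε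

/-- Weak σ-distributivity: for every order bounded double sequence `a` such that each row
`(a i j)_j` is an (o)-sequence, the infimum over `φ : ℕ → ℕ` of the elements
`⨆ i, a i (φ i)` is `0`. -/
def IsWeaklySigmaDistributive (X : Type*) [Zero X] [PartialOrder X] : Prop :=
  ∀ a : ℕ → ℕ → X, (∃ u : X, ∀ i j, a i j ≤ u) → (∀ i, IsOSequence (a i)) →
    IsGLB {s : X | ∃ φ : ℕ → ℕ, IsLUB (range fun i => a i (φ i)) s} 0

/-- `cwk X`: the nonempty, bounded, closed, convex and weakly compact subsets of `X`. -/
def cwk (X : Type*) [NormedAddCommGroup X] [NormedSpace ℝ X] : Set (Set X) :=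
  {A | A.Nonempty ∧ Bornology.IsBounded A ∧ IsClosed A ∧ Convex ℝ A ∧
    IsCompact (toWeakSpace ℝ X '' A)}

/-- The set `𝒰(C, b)` of all `z` with `|z - y| ≤ b` for some `y ∈ C`. -/
def orderNhd {X : Type*} [Lattice X] [AddGroup X] (C : Set X) (b : X) : Set X :=
  {z | ∃ y ∈ C, |z - y| ≤ b}

/-- A (tagged) partition of `E ⊆ T`: finitely many pairs `(E_i, t_i)`, with measurable `E_i`
overlapping in null sets only and having union `E`, and with tags `t_i ∈ T`, not required to lie
in `E_i`. -/
structure TaggedPartition {T : Type*} [MeasurableSpace T] (μ : Measure T) (E : Set T) where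
  card : ℕ
  part : Fin card → Set T
  tag : Fin card → T
  measurableSet_part : ∀ i, MeasurableSet (part i)
  measure_inter : ∀ i j, i ≠ j → μ (part i ∩ part j) = 0
  iUnion_part : ⋃ i, part i = E

/-- A gauge on `T`: a strictly positive function. -/
def IsGauge {T : Type*} (γ : T → ℝ) : Prop := ∀ t, 0 < γ t

/-- The partition `P` is `γ`-fine: `d(w, t_i) < γ(t_i)` for all `i` and all `w ∈ E_i`. -/
def TaggedPartition.IsFine {T : Type*} [MetricSpace T] [MeasurableSpace T] {μ : Measure T}
    {E : Set T} (P : TaggedPartition μ E) (γ : T → ℝ) : Prop :=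
  ∀ i, ∀ w ∈ P.part i, dist w (P.tag i) < γ (P.tag i)

/-- The Riemann sum of the multifunction `F`: the closure of the Minkowski sum
`μ(E_1) F(t_1) + ⋯ + μ(E_k) F(t_k)`. -/
def TaggedPartition.sum {T : Type*} [MeasurableSpace T] {μ : Measure T} {E : Set T}
    {X : Type*} [NormedAddCommGroup X] [NormedSpace ℝ X]
    (P : TaggedPartition μ E) (F : T → cwk X) : Set X :=
  closure (∑ i, μ.real (P.part i) • (F (P.tag i) : Set X))

/-- `J` is the (oH)-integral of `F` over `E`. -/
def HasOHIntegral {T : Type*} [MetricSpace T] [MeasurableSpace T] (μ : Measure T)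
    {X : Type*} [NormedAddCommGroup X] [NormedSpace ℝ X] [Lattice X]
    (F : T → cwk X) (E : Set T) (J : cwk X) : Prop :=
  ∃ (b : ℕ → X) (γ : ℕ → T → ℝ), IsOSequence b ∧ (∀ n, IsGauge (γ n)) ∧
    ∀ n, ∀ P : TaggedPartition μ E, P.IsFine (γ n) →
      P.sum F ⊆ orderNhd (J : Set X) (b n) ∧ (J : Set X) ⊆ orderNhd (P.sum F) (b n)

/-- `F` is (oH)-integrable: it has an (oH)-integral over every measurable set. -/
def OHIntegrable {T : Type*} [MetricSpace T] [MeasurableSpace T] (μ : Measure T)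
    {X : Type*} [NormedAddCommGroup X] [NormedSpace ℝ X] [Lattice X]
    (F : T → cwk X) : Prop :=
  ∀ E : Set T, MeasurableSet E → ∃ J : cwk X, HasOHIntegral μ F E J

/-- All values of the multifunction `F` are order bounded. -/
def HasOrderBoundedValues {T X : Type*} [NormedAddCommGroup X] [NormedSpace ℝ X] [Preorder X]
    (F : T → cwk X) : Prop :=
  ∀ t, BddBelow (F t : Set X) ∧ BddAbove (F t : Set X)

/-! ### Order neighbourhoods of sets. -/

section OrderNhd

variable {X : Type*} [NormedAddCommGroup X] [Lattice X]

/-! Fix `E` and let `K₁ n`, `K₂ n` be the integrals over `E` of the inner and outer multifunctions.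
Monotonicity gives `K₁ n ⊆ K₂ m` for all `n`, `m`, so `⋂ m, K₂ m` lies between `K₁ n` and `K₂ n` for
every `n` and is the integral of `F`.

Two points need work. The estimate by `b n` is given only over `T`: additivity of the integral over
`E` and its complement, followed by Rådström's cancellation of the complementary part, carries it to
`E`. Moreover, the (o)-sequences of the approximating multifunctions change with `n`. Order
continuity of the norm lets one pick for each `n` a single gauge with error of norm below `2⁻ⁿ`;
these errors are summable, hence dominated by one (o)-sequence. -/

theorem orderNhd_mono {C D : Set X} {b c : X} (hCD : C ⊆ D) (hbc : b ≤ c) :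
    orderNhd C b ⊆ orderNhd D c := by
  rintro z ⟨y, hy, hz⟩
  exact ⟨y, hCD hy, hz.trans hbc⟩

theorem orderNhd_subset_thickening [HasSolidNorm X] (C : Set X) {b : X} {ε : ℝ}
    (hb : ‖b‖ < ε) : orderNhd C b ⊆ Metric.thickening ε C := by
  rintro z ⟨y, hy, hz⟩
  refine Metric.mem_thickening_iff.2 ⟨y, hy, ?_⟩
  rw [dist_eq_norm]
  exact (norm_le_norm_of_abs_le_abs (hz.trans (le_abs_self b))).trans_lt hb

theorem subset_closure_of_subset_orderNhd [HasSolidNorm X] {A C : Set X}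
    (h : ∀ ε : ℝ, 0 < ε → ∃ b : X, ‖b‖ < ε ∧ A ⊆ orderNhd C b) : A ⊆ closure C := by
  rw [Metric.closure_eq_iInter_thickening]
  refine subset_iInter₂ fun ε hε => ?_
  obtain ⟨b, hb, hA⟩ := h ε hε
  exact hA.trans (orderNhd_subset_thickening C hb)

variable [IsOrderedAddMonoid X]

theorem orderNhd_orderNhd_subset (C : Set X) (b c : X) :
    orderNhd (orderNhd C b) c ⊆ orderNhd C (b + c) := by
  rintro z ⟨y, ⟨x, hx, hyx⟩, hzy⟩
  refine ⟨x, hx, ?_⟩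
  calc |z - x| = |(y - x) + (z - y)| := by congr 1; abel
    _ ≤ |y - x| + |z - y| := abs_add_le _ _
    _ ≤ b + c := add_le_add hyx hzy

theorem orderNhd_add_subset (C D : Set X) (b c : X) :
    orderNhd C b + orderNhd D c ⊆ orderNhd (C + D) (b + c) := by
  rintro _ ⟨x, ⟨y, hy, hxy⟩, x', ⟨y', hy', hxy'⟩, rfl⟩
  refine ⟨y + y', add_mem_add hy hy', ?_⟩
  calc |x + x' - (y + y')| = |(x - y) + (x' - y')| := by congr 1; abel
    _ ≤ |x - y| + |x' - y'| := abs_add_le _ _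
    _ ≤ b + c := add_le_add hxy hxy'

/-- As a Minkowski sum, the neighbourhood inherits convexity and closedness, and commutes with
adding a further set. -/
theorem orderNhd_eq_add_Icc (C : Set X) (b : X) : orderNhd C b = C + Icc (-b) b := by
  ext z
  constructor
  · rintro ⟨y, hy, hz⟩
    exact ⟨y, hy, z - y, ⟨neg_le.1 (abs_le'.1 hz).2, (abs_le'.1 hz).1⟩, by simp⟩
  · rintro ⟨y, hy, w, hw, rfl⟩
    exact ⟨y, hy, by simpa using abs_le'.2 ⟨hw.2, neg_le.1 hw.1⟩⟩

end OrderNhd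

/-! ### (o)-sequences and norm convergence. -/

section OSequence

variable {X : Type*} [NormedAddCommGroup X] [Lattice X]

theorem IsOSequence.nonneg {b : ℕ → X} (hb : IsOSequence b) (n : ℕ) : 0 ≤ b n :=
  hb.2.1 (mem_range_self n)

variable [IsOrderedAddMonoid X] [HasSolidNorm X]

theorem norm_le_norm_of_nonneg_of_le {x y : X} (hx : 0 ≤ x) (hxy : x ≤ y) : ‖x‖ ≤ ‖y‖ :=
  norm_le_norm_of_abs_le_abs (by rwa [abs_of_nonneg hx, abs_of_nonneg (hx.trans hxy)])

theorem IsOSequence.tendsto_zero (hcont : IsOrderContinuousNorm X) {b : ℕ → X}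
    (hb : IsOSequence b) : Filter.Tendsto b Filter.atTop (nhds 0) := by
  rw [Metric.tendsto_atTop]
  intro ε hε
  obtain ⟨_, ⟨N, rfl⟩, hN⟩ := hcont (range b) (range_nonempty b)
    (directedOn_range.2 hb.1.directed_ge) hb.2 ε hε
  refine ⟨N, fun n hn => ?_⟩
  rw [dist_zero_right]
  exact (norm_le_norm_of_nonneg_of_le (hb.nonneg n) (hb.1 hn)).trans_lt hN

theorem isOSequence_of_antitone_of_tendsto {b : ℕ → X} (hb : Antitone b)
    (hlim : Filter.Tendsto b Filter.atTop (nhds 0)) : IsOSequence b :=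
  ⟨hb, isGLB_of_tendsto_atTop hb hlim⟩

/-- A norm-summable sequence of positive elements is dominated by an (o)-sequence. -/
theorem exists_isOSequence_le_of_summable {c : ℕ → X} (hc : ∀ n, 0 ≤ c n)
    (hs : Summable c) : ∃ e : ℕ → X, IsOSequence e ∧ c ≤ e := by
  have hs' : ∀ n, Summable fun k => c (k + n) := fun n => (summable_nat_add_iff n).2 hs
  have hstep : ∀ n, ∑' k, c (k + n) = c n + ∑' k, c (k + (n + 1)) := fun n => by
    rw [(hs' n).tsum_eq_zero_add, zero_add]
    congr 2
    ext k
    congr 1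
    omega
  -- The tails of the series decrease, tend to `0` in norm, and dominate their first terms.
  refine ⟨fun n => ∑' k, c (k + n), isOSequence_of_antitone_of_tendsto
    (antitone_nat_of_succ_le fun n => ?_) (tendsto_sum_nat_add c), fun n => ?_⟩
  · rw [hstep n]
    exact le_add_of_nonneg_left (hc n)
  · refine le_of_le_of_eq ?_ (hstep n).symm
    exact le_add_of_nonneg_right (tsum_nonneg fun k => hc _)

end OSequence

/-! ### Weakly compact convex sets and cancellation. -/

section WeaklyCompact

variable {X : Type*} [NormedAddCommGroup X] [NormedSpace ℝ X]

theorem Convex.isClosed_toWeakSpace_image {A : Set X} (hA : Convex ℝ A) (hc : IsClosed A) :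
    IsClosed (toWeakSpace ℝ X '' A) := by
  rw [← closure_eq_iff_isClosed, ← hA.toWeakSpace_closure (𝕜 := ℝ), hc.closure_eq]

/-- A closed convex set is weakly closed, compact plus closed is closed in the weak topology, and
weakly closed sets are norm closed. -/
theorem isClosed_add_of_isCompact_toWeakSpace {A B : Set X}
    (hA : IsCompact (toWeakSpace ℝ X '' A)) (hB : Convex ℝ B) (hBc : IsClosed B) :
    IsClosed (A + B) := by
  have h := ((hB.isClosed_toWeakSpace_image hBc).add_left_of_isCompact hA).preimage
    (toWeakSpaceCLM ℝ X).continuous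
  rw [← image_add (toWeakSpace ℝ X)] at h
  convert h
  exact (preimage_image_eq (A + B) (toWeakSpace ℝ X).injective).symm

theorem cwk.isClosed_add (A B : cwk X) : IsClosed ((A : Set X) + (B : Set X)) :=
  isClosed_add_of_isCompact_toWeakSpace A.2.2.2.2.2 B.2.2.2.2.1 B.2.2.2.1

theorem iInter_mem_cwk {ι : Type*} [Nonempty ι] (A : ι → cwk X)
    (hne : (⋂ i, (A i : Set X)).Nonempty) : (⋂ i, (A i : Set X)) ∈ cwk X := by
  obtain ⟨i⟩ := ‹Nonempty ι›
  have hcl : IsClosed (⋂ i, (A i : Set X)) := isClosed_iInter fun i => (A i).2.2.2.1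
  have hcv : Convex ℝ (⋂ i, (A i : Set X)) := convex_iInter fun i => (A i).2.2.2.2.1
  refine ⟨hne, (A i).2.2.1.subset (iInter_subset _ i), hcl, hcv, ?_⟩
  exact (A i).2.2.2.2.2.of_isClosed_subset (hcv.isClosed_toWeakSpace_image hcl)
    (image_mono (iInter_subset _ i))

/-- Rådström's cancellation law. -/
theorem subset_of_add_subset_add_of_convex {A B C : Set X} (hB : Convex ℝ B)
    (hBc : IsClosed B) (hC : Bornology.IsBounded C) (hCne : C.Nonempty)
    (h : A + C ⊆ B + C) : A ⊆ B := by
  intro a ha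
  by_contra haB
  obtain ⟨f, u, hfa, hfB⟩ := geometric_hahn_banach_point_closed hB hBc haB
  have hbdd : BddBelow (f '' C) :=
    (f.lipschitz.isBounded_image hC).bddBelow
  -- `c` minimizes `f` on `C` up to less than the separation gap `u - f a`, so `a + c` cannot lie in
  -- `B + C`.
  obtain ⟨_, ⟨c, hc, rfl⟩, hlt⟩ := exists_lt_of_csInf_lt (hCne.image f)
    (lt_add_of_pos_right (sInf (f '' C)) (sub_pos.2 hfa))
  obtain ⟨b', hb', c', hc', heq⟩ := h (add_mem_add ha hc)
  have h1 : f b' + f c' = f a + f c := by rw [← map_add, ← map_add]; exact congrArg f heq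
  have h2 := hfB b' hb'
  have h3 := csInf_le hbdd (mem_image_of_mem f hc')
  linarith

theorem isClosed_orderNhd [Lattice X] [IsOrderedAddMonoid X] [IsOrderedModule ℝ X]
    [HasSolidNorm X] (A : cwk X) (b : X) : IsClosed (orderNhd (A : Set X) b) := by
  rw [orderNhd_eq_add_Icc]
  exact isClosed_add_of_isCompact_toWeakSpace A.2.2.2.2.2 (convex_Icc _ _) isClosed_Icc

theorem convex_orderNhd [Lattice X] [IsOrderedAddMonoid X] [IsOrderedModule ℝ X]
    (A : cwk X) (b : X) : Convex ℝ (orderNhd (A : Set X) b) := by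
  rw [orderNhd_eq_add_Icc]
  exact A.2.2.2.2.1.add (convex_Icc _ _)

end WeaklyCompact

/-! ### Fine partitions. -/

section Partition

theorem IsGauge.inf {T : Type*} {γ δ : T → ℝ} (hγ : IsGauge γ) (hδ : IsGauge δ) :
    IsGauge (γ ⊓ δ) := fun t => lt_min (hγ t) (hδ t)

namespace TaggedPartition

variable {T : Type*} [MeasurableSpace T] {μ : Measure T}

theorem IsFine.mono [MetricSpace T] {E : Set T} {P : TaggedPartition μ E}
    {γ δ : T → ℝ} (hP : P.IsFine γ) (h : γ ≤ δ) : P.IsFine δ :=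
  fun i w hw => (hP i w hw).trans_le (h _)

/-- Finitely many balls of radius `γ t` cover `T`. Since tags may lie outside their pieces, the
balls can be made disjoint and cut down to `E`. -/
theorem exists_isFine [MetricSpace T] [CompactSpace T] [BorelSpace T] {E : Set T}
    (hE : MeasurableSet E) {γ : T → ℝ} (hγ : IsGauge γ) :
    ∃ P : TaggedPartition μ E, P.IsFine γ := by
  obtain ⟨s, hs⟩ := isCompact_univ.elim_nhds_subcover (fun t => Metric.ball t (γ t))
    fun t _ => Metric.ball_mem_nhds t (hγ t)
  let tag : Fin s.card → T := fun i => s.equivFin.symm i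
  let B : Fin s.card → Set T := fun i => Metric.ball (tag i) (γ (tag i))
  have hB : ⋃ i, B i = univ := by
    refine eq_univ_of_forall fun t => ?_
    obtain ⟨x, hx, ht⟩ := mem_iUnion₂.1 (hs.2 (mem_univ t))
    exact mem_iUnion.2 ⟨s.equivFin ⟨x, hx⟩, by simpa [B, tag] using ht⟩
  refine ⟨⟨s.card, fun i => disjointed B i ∩ E, tag, fun i => ?_, fun i j hij => ?_, ?_⟩, ?_⟩
  · refine MeasurableSet.inter ?_ hE
    exact disjointedRec (fun _ j ht => ht.diff Metric.isOpen_ball.measurableSet)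
      Metric.isOpen_ball.measurableSet
  · have : Disjoint (disjointed B i ∩ E) (disjointed B j ∩ E) :=
      (disjoint_disjointed B hij).mono inter_subset_left inter_subset_left
    rw [this.inter_eq, measure_empty]
  · rw [← iUnion_inter, iUnion_disjointed, hB, univ_inter]
  · exact fun i w hw => disjointed_subset B i hw.1

/-- The juxtaposition of partitions of two disjoint sets. -/
def append {E E' E'' : Set T} (P : TaggedPartition μ E) (Q : TaggedPartition μ E')
    (hd : Disjoint E E') (hu : E ∪ E' = E'') : TaggedPartition μ E'' where
  card := P.card + Q.card
  part := Fin.append P.part Q.part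
  tag := Fin.append P.tag Q.tag
  measurableSet_part i := by
    induction i using Fin.addCases <;> simp [P.measurableSet_part, Q.measurableSet_part]
  measure_inter i j hij := by
    have hPQ : ∀ i j, μ (P.part i ∩ Q.part j) = 0 := fun i j => by
      have : Disjoint (P.part i) (Q.part j) := hd.mono
        ((subset_iUnion _ i).trans_eq P.iUnion_part) ((subset_iUnion _ j).trans_eq Q.iUnion_part)
      rw [this.inter_eq, measure_empty]
    induction i using Fin.addCases with
    | left i =>
      induction j using Fin.addCases with
      | left j => simpa using P.measure_inter i j (by rintro rfl; exact hij rfl)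
      | right j => simpa using hPQ i j
    | right i =>
      induction j using Fin.addCases with
      | left j => simpa [inter_comm] using hPQ j i
      | right j => simpa using Q.measure_inter i j (by rintro rfl; exact hij rfl)
  iUnion_part := by
    refine Eq.trans ?_ ((congrArg₂ (· ∪ ·) P.iUnion_part Q.iUnion_part).trans hu)
    ext x
    simp only [mem_iUnion, mem_union]
    constructor
    · rintro ⟨i, hi⟩
      induction i using Fin.addCases with
      | left i => exact .inl ⟨i, by simpa using hi⟩
      | right i => exact .inr ⟨i, by simpa using hi⟩
    · rintro (⟨i, hi⟩ | ⟨i, hi⟩)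
      · exact ⟨Fin.castAdd _ i, by simpa using hi⟩
      · exact ⟨Fin.natAdd _ i, by simpa using hi⟩

variable {E E' E'' : Set T} {P : TaggedPartition μ E} {Q : TaggedPartition μ E'}
  {hd : Disjoint E E'} {hu : E ∪ E' = E''}

theorem IsFine.append [MetricSpace T] {γ : T → ℝ} (hP : P.IsFine γ) (hQ : Q.IsFine γ) :
    (P.append Q hd hu).IsFine γ := by
  intro i
  induction i using Fin.addCases with
  | left i => simpa [TaggedPartition.append] using hP i
  | right i => simpa [TaggedPartition.append] using hQ i

variable {X : Type*} [NormedAddCommGroup X] [NormedSpace ℝ X]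

theorem sum_append (F : T → cwk X) : (P.append Q hd hu).sum F =
    closure ((∑ i, μ.real (P.part i) • (F (P.tag i) : Set X)) +
      ∑ i, μ.real (Q.part i) • (F (Q.tag i) : Set X)) := by
  unfold TaggedPartition.sum
  congr 1
  refine (Fin.sum_univ_add (a := P.card) (b := Q.card) _).trans ?_
  simp [TaggedPartition.append]

theorem sum_add_sum_subset_sum_append (F : T → cwk X) :
    P.sum F + Q.sum F ⊆ (P.append Q hd hu).sum F := by
  rw [sum_append]
  rintro _ ⟨x, hx, y, hy, rfl⟩
  exact map_mem_closure₂ continuous_add hx hy fun _ ha _ hb => add_mem_add ha hb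

theorem sum_append_subset_closure (F : T → cwk X) :
    (P.append Q hd hu).sum F ⊆ closure (P.sum F + Q.sum F) := by
  rw [sum_append]
  exact closure_mono (add_subset_add subset_closure subset_closure)

theorem sum_mono {F G : T → cwk X} (h : ∀ t, (F t : Set X) ⊆ G t) : P.sum F ⊆ P.sum G :=
  closure_mono (finsetSum_subset_finsetSum _ _ _ fun _ _ => smul_set_mono (h _))

end TaggedPartition

end Partition

/-! ### Monotonicity and additivity of the integral. -/

section Integral

variable {T : Type*} [MetricSpace T] [MeasurableSpace T] {μ : Measure T}
  {X : Type*} [NormedAddCommGroup X] [NormedSpace ℝ X]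
  [Lattice X] [IsOrderedAddMonoid X] [HasSolidNorm X]

theorem HasOHIntegral.exists_gauge (hcont : IsOrderContinuousNorm X) {F : T → cwk X}
    {E : Set T} {J : cwk X} (h : HasOHIntegral μ F E J) {ε : ℝ} (hε : 0 < ε) :
    ∃ (γ : T → ℝ) (c : X), IsGauge γ ∧ 0 ≤ c ∧ ‖c‖ < ε ∧
      ∀ P : TaggedPartition μ E, P.IsFine γ →
        P.sum F ⊆ orderNhd (J : Set X) c ∧ (J : Set X) ⊆ orderNhd (P.sum F) c := by
  obtain ⟨b, γ, hb, hγ, h⟩ := h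
  obtain ⟨n, hn⟩ := ((hb.tendsto_zero hcont).norm.eventually
    (gt_mem_nhds (by simpa using hε))).exists
  exact ⟨γ n, b n, hγ n, hb.nonneg n, hn, h n⟩

variable [CompactSpace T] [BorelSpace T]

theorem HasOHIntegral.mono (hcont : IsOrderContinuousNorm X) {F G : T → cwk X}
    {E : Set T} (hE : MeasurableSet E) {J K : cwk X} (hF : HasOHIntegral μ F E J)
    (hG : HasOHIntegral μ G E K) (hFG : ∀ t, (F t : Set X) ⊆ G t) :
    (J : Set X) ⊆ K := by
  rw [← K.2.2.2.1.closure_eq]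
  refine subset_closure_of_subset_orderNhd fun ε hε => ?_
  obtain ⟨γ, c, hγ, -, hcε, hc⟩ := hF.exists_gauge hcont (half_pos hε)
  obtain ⟨δ, d, hδ, -, hdε, hd⟩ := hG.exists_gauge hcont (half_pos hε)
  obtain ⟨P, hP⟩ := TaggedPartition.exists_isFine (μ := μ) hE (hγ.inf hδ)
  refine ⟨d + c, (norm_add_le d c).trans_lt (by linarith), ?_⟩
  calc (J : Set X) ⊆ orderNhd (P.sum F) c := (hc P (hP.mono inf_le_left)).2
    _ ⊆ orderNhd (P.sum G) c := orderNhd_mono (TaggedPartition.sum_mono hFG) le_rfl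
    _ ⊆ orderNhd (orderNhd (K : Set X) d) c :=
      orderNhd_mono (hd P (hP.mono inf_le_right)).1 le_rfl
    _ ⊆ orderNhd (K : Set X) (d + c) := orderNhd_orderNhd_subset _ _ _

theorem HasOHIntegral.add_eq (hcont : IsOrderContinuousNorm X) {F : T → cwk X}
    {E E' E'' : Set T} (hE : MeasurableSet E) (hE' : MeasurableSet E')
    (hdisj : Disjoint E E') (hu : E ∪ E' = E'') {J J' J'' : cwk X}
    (hJ : HasOHIntegral μ F E J) (hJ' : HasOHIntegral μ F E' J')
    (hJ'' : HasOHIntegral μ F E'' J'') : (J : Set X) + (J' : Set X) = J'' := by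
  have key : ∀ ε : ℝ, 0 < ε → ∃ (P : TaggedPartition μ E) (Q : TaggedPartition μ E') (c c' c'' : X),
      ‖c + c'‖ < ε / 2 ∧ ‖c''‖ < ε / 2 ∧
      (P.sum F ⊆ orderNhd (J : Set X) c ∧ (J : Set X) ⊆ orderNhd (P.sum F) c) ∧
      (Q.sum F ⊆ orderNhd (J' : Set X) c' ∧ (J' : Set X) ⊆ orderNhd (Q.sum F) c') ∧
      ((P.append Q hdisj hu).sum F ⊆ orderNhd (J'' : Set X) c'' ∧
        (J'' : Set X) ⊆ orderNhd ((P.append Q hdisj hu).sum F) c'') := by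
    intro ε hε
    have hε6 : 0 < ε / 6 := by positivity
    obtain ⟨γ, c, hγ, -, hcε, hc⟩ := hJ.exists_gauge hcont hε6
    obtain ⟨γ', c', hγ', -, hcε', hc'⟩ := hJ'.exists_gauge hcont hε6
    obtain ⟨γ'', c'', hγ'', -, hcε'', hc''⟩ := hJ''.exists_gauge hcont hε6
    have hg := (hγ.inf hγ').inf hγ''
    obtain ⟨P, hP⟩ := TaggedPartition.exists_isFine (μ := μ) hE hg
    obtain ⟨Q, hQ⟩ := TaggedPartition.exists_isFine (μ := μ) hE' hg
    refine ⟨P, Q, c, c', c'', (norm_add_le c c').trans_lt (by linarith), by linarith,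
      hc P (hP.mono (inf_le_left.trans inf_le_left)),
      hc' Q (hQ.mono (inf_le_left.trans inf_le_right)),
      hc'' _ ((hP.append hQ).mono inf_le_right)⟩
  apply Subset.antisymm
  · rw [← J''.2.2.2.1.closure_eq]
    refine subset_closure_of_subset_orderNhd fun ε hε => ?_
    obtain ⟨P, Q, c, c', c'', hn, hn'', hP, hQ, hR⟩ := key ε hε
    refine ⟨c'' + (c + c'), (norm_add_le _ _).trans_lt (by linarith), ?_⟩
    calc (J : Set X) + (J' : Set X) ⊆ orderNhd (P.sum F) c + orderNhd (Q.sum F) c' :=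
        add_subset_add hP.2 hQ.2
      _ ⊆ orderNhd (P.sum F + Q.sum F) (c + c') := orderNhd_add_subset _ _ _ _
      _ ⊆ orderNhd (orderNhd (J'' : Set X) c'') (c + c') :=
        orderNhd_mono ((TaggedPartition.sum_add_sum_subset_sum_append F).trans hR.1) le_rfl
      _ ⊆ _ := orderNhd_orderNhd_subset _ _ _
  -- The Riemann sum of the joined partition is only in the closure of `P.sum F + Q.sum F`; metric
  -- thickenings ignore this closure.
  · rw [← (cwk.isClosed_add J J').closure_eq, Metric.closure_eq_iInter_thickening]
    refine subset_iInter₂ fun ε hε => ?_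
    obtain ⟨P, Q, c, c', c'', hn, hn'', hP, hQ, hR⟩ := key ε hε
    have hsum : P.sum F + Q.sum F ⊆ orderNhd ((J : Set X) + (J' : Set X)) (c + c') :=
      (add_subset_add hP.1 hQ.1).trans (orderNhd_add_subset _ _ _ _)
    calc (J'' : Set X) ⊆ Metric.thickening (ε / 2) ((P.append Q hdisj hu).sum F) :=
        hR.2.trans (orderNhd_subset_thickening _ hn'')
      _ ⊆ Metric.thickening (ε / 2) (closure (P.sum F + Q.sum F)) :=
        Metric.thickening_subset_of_subset _ (TaggedPartition.sum_append_subset_closure F)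
      _ = Metric.thickening (ε / 2) (P.sum F + Q.sum F) := Metric.thickening_closure
      _ ⊆ Metric.thickening (ε / 2) (Metric.thickening (ε / 2) ((J : Set X) + (J' : Set X))) :=
        Metric.thickening_subset_of_subset _
          (hsum.trans (orderNhd_subset_thickening _ hn))
      _ ⊆ Metric.thickening ε ((J : Set X) + (J' : Set X)) := by
        simpa using Metric.thickening_thickening_subset (ε / 2) (ε / 2) ((J : Set X) + (J' : Set X))

/-- An order estimate between the integrals of nested multifunctions over the whole space passes
to measurable subsets. -/
theorem HasOHIntegral.subset_orderNhd_of_univ [IsOrderedModule ℝ X]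
    (hcont : IsOrderContinuousNorm X) {G₁ G₂ : T → cwk X}
    (hG₁ : OHIntegrable μ G₁) (hG₂ : OHIntegrable μ G₂)
    (hG : ∀ t, (G₁ t : Set X) ⊆ G₂ t) {J₁ J₂ : cwk X}
    (hJ₁ : HasOHIntegral μ G₁ univ J₁) (hJ₂ : HasOHIntegral μ G₂ univ J₂) {b : X}
    (hb : (J₂ : Set X) ⊆ orderNhd (J₁ : Set X) b) {E : Set T} (hE : MeasurableSet E)
    {K₁ K₂ : cwk X} (hK₁ : HasOHIntegral μ G₁ E K₁) (hK₂ : HasOHIntegral μ G₂ E K₂) :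
    (K₂ : Set X) ⊆ orderNhd (K₁ : Set X) b := by
  obtain ⟨L₁, hL₁⟩ := hG₁ Eᶜ hE.compl
  obtain ⟨L₂, hL₂⟩ := hG₂ Eᶜ hE.compl
  have h₁ := hK₁.add_eq hcont hE hE.compl disjoint_compl_right (union_compl_self E) hL₁ hJ₁
  have h₂ := hK₂.add_eq hcont hE hE.compl disjoint_compl_right (union_compl_self E) hL₂ hJ₂
  -- Cancelling `L₁`, rather than `L₂`, works because `L₁ ⊆ L₂` enlarges only the left-hand sum.
  refine subset_of_add_subset_add_of_convex (convex_orderNhd K₁ b) (isClosed_orderNhd K₁ b)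
    L₁.2.2.1 L₁.2.1 ?_
  calc (K₂ : Set X) + (L₁ : Set X) ⊆ (K₂ : Set X) + (L₂ : Set X) :=
      add_subset_add_left (hL₁.mono hcont hE.compl hL₂ hG)
    _ = J₂ := h₂
    _ ⊆ orderNhd (J₁ : Set X) b := hb
    _ = orderNhd (K₁ : Set X) b + (L₁ : Set X) := by
      rw [← h₁, orderNhd_eq_add_Icc, orderNhd_eq_add_Icc, add_right_comm]

end Integral

theorem proposition3p21
    {T : Type*} [MetricSpace T] [CompactSpace T] [MeasurableSpace T] [BorelSpace T]
    (μ : Measure T) [IsFiniteMeasure μ] [NullSingletonClass μ]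
    {X : Type*} [NormedAddCommGroup X] [NormedSpace ℝ X] [CompleteSpace X]
    [Lattice X] [IsOrderedAddMonoid X] [IsOrderedModule ℝ X] [HasSolidNorm X]
    (hcont : IsOrderContinuousNorm X) (hdist : IsWeaklySigmaDistributive X)
    (F : T → cwk X) (hF : HasOrderBoundedValues F)
    (b : ℕ → X) (hb : IsOSequence b)
    (hsqueeze : ∀ n, ∃ G₁ G₂ : T → cwk X,
      HasOrderBoundedValues G₁ ∧ HasOrderBoundedValues G₂ ∧
      OHIntegrable μ G₁ ∧ OHIntegrable μ G₂ ∧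
      (∀ t, (G₁ t : Set X) ⊆ (F t : Set X) ∧ (F t : Set X) ⊆ (G₂ t : Set X)) ∧
      ∃ J₁ J₂ : cwk X, HasOHIntegral μ G₁ univ J₁ ∧ HasOHIntegral μ G₂ univ J₂ ∧
        (J₂ : Set X) ⊆ orderNhd (J₁ : Set X) (b n)) :
    OHIntegrable μ F := by
  intro E hE
  choose G₁ G₂ _ _ hG₁ hG₂ hsub J₁ J₂ hJ₁ hJ₂ hJb using hsqueeze
  choose K₁ hK₁ using fun n => hG₁ n E hE
  choose K₂ hK₂ using fun n => hG₂ n E hE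
  have hKb : ∀ n, (K₂ n : Set X) ⊆ orderNhd (K₁ n : Set X) (b n) := fun n =>
    HasOHIntegral.subset_orderNhd_of_univ hcont (hG₁ n) (hG₂ n)
      (fun t => (hsub n t).1.trans (hsub n t).2) (hJ₁ n) (hJ₂ n) (hJb n) hE (hK₁ n) (hK₂ n)
  have hK : ∀ n m, (K₁ n : Set X) ⊆ K₂ m := fun n m =>
    (hK₁ n).mono hcont hE (hK₂ m) fun t => (hsub n t).1.trans (hsub m t).2
  have hKJ : ∀ n, (K₁ n : Set X) ⊆ ⋂ m, (K₂ m : Set X) := fun n => subset_iInter (hK n)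
  have hpow : ∀ n : ℕ, (0 : ℝ) < (1 / 2) ^ n := fun n => by positivity
  choose γ₁ c₁ hγ₁ hc₁ hc₁n h₁ using fun n => (hK₁ n).exists_gauge hcont (hpow n)
  choose γ₂ c₂ hγ₂ hc₂ hc₂n h₂ using fun n => (hK₂ n).exists_gauge hcont (hpow n)
  obtain ⟨e₁, he₁, hce₁⟩ := exists_isOSequence_le_of_summable hc₁
    (.of_norm_bounded summable_geometric_two fun n => (hc₁n n).le)
  obtain ⟨e₂, he₂, hce₂⟩ := exists_isOSequence_le_of_summable hc₂
    (.of_norm_bounded summable_geometric_two fun n => (hc₂n n).le)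
  refine ⟨⟨⋂ n, (K₂ n : Set X), iInter_mem_cwk K₂ ((K₁ 0).2.1.mono (hKJ 0))⟩,
    b + (e₁ + e₂), γ₁ ⊓ γ₂, ?_, fun n => (hγ₁ n).inf (hγ₂ n), fun n P hP => ⟨?_, ?_⟩⟩
  · refine isOSequence_of_antitone_of_tendsto (hb.1.add (he₁.1.add he₂.1)) ?_
    simpa [Pi.add_def] using (hb.tendsto_zero hcont).add
      ((he₁.tendsto_zero hcont).add (he₂.tendsto_zero hcont))
  · calc P.sum F ⊆ P.sum (G₂ n) := TaggedPartition.sum_mono fun t => (hsub n t).2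
      _ ⊆ orderNhd (K₂ n : Set X) (c₂ n) := (h₂ n P (hP.mono inf_le_right)).1
      _ ⊆ orderNhd (orderNhd (K₁ n : Set X) (b n)) (c₂ n) := orderNhd_mono (hKb n) le_rfl
      _ ⊆ orderNhd (K₁ n : Set X) (b n + c₂ n) := orderNhd_orderNhd_subset _ _ _
      _ ⊆ _ := orderNhd_mono (hKJ n) (add_le_add_right
        ((hce₂ n).trans (le_add_of_nonneg_left (he₁.nonneg n))) _)
  · calc (⋂ m, (K₂ m : Set X)) ⊆ K₂ n := iInter_subset _ n
      _ ⊆ orderNhd (K₁ n : Set X) (b n) := hKb n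
      _ ⊆ orderNhd (orderNhd (P.sum (G₁ n)) (c₁ n)) (b n) :=
        orderNhd_mono (h₁ n P (hP.mono inf_le_left)).2 le_rfl
      _ ⊆ orderNhd (P.sum (G₁ n)) (c₁ n + b n) := orderNhd_orderNhd_subset _ _ _
      _ ⊆ _ := orderNhd_mono (TaggedPartition.sum_mono fun t => (hsub n t).1) <| by
        rw [add_comm]
        exact add_le_add_right
          ((hce₁ n).trans (le_add_of_nonneg_right (he₂.nonneg n))) _
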